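/- Let $\mathcal D$ be a digraph on a countable (finite or infinite) vertex set $V$; loops are allowed, multiple arcs are not. Assume that $\mathcal D$ is strong, i.e. for any two distinct vertices $v,w$ there is a directed path from $v$ to $w$, and that $\mathcal D$ has at least one arc. A directed cycle of length $n\ge 1$ consists of $n$ distinct vertices $c_0,\dots,c_{n-1}$ with arcs $c_0\to c_1\to\dots\to c_{n-1}\to c_0$ (a loop is a cycle of length one). A set $W\subseteq V$ is a cycle transversal of $\mathcal D$ if the digraph obtained by deleting the vertices of $W$ and all arcs incident with them has no cycles. For a nonnegative real matrix $M=(M(v,w))_{v,w\in V}$, let $\lambda(M)\in[0,\infty]$ be the supremum of the spectral radii of its finite principal submatrices; the digraph of $M$ has vertex set $V$ and an arc $(v,w)$ exactly when $M(v,w)\neq 0$. The matrix $M$ is transient if $\lambda(M)<\infty$ and the series $\sum_{p=0}^{\infty}M^{p}\lambda(M)^{-p}$ converges entrywise. Let $\mathcal T(\mathcal D)$ be the set of all transient nonnegative matrices whose digraph is $\mathcal D$. Theorem 1 (V. Cyr's criterion). $\mathcal T(\mathcal D)=\emptyset$ if and only if $\mathcal D$ admits a finite cycle transversal and the lengths of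 all cycles of $\mathcal D$ are uniformly bounded above. -/

import Mathlib

open scoped NNReal ENNReal

namespace InfDigraph

/-- A digraph is strong if there is a (directed) path from `v` to `w` for any pair of
distinct vertices `v`, `w`. -/
def IsStrong {V : Type*} (D : Digraph V) : Prop :=
  ∀ v w : V, v ≠ w → Relation.ReflTransGen D.Adj v w

/-- `D` has a directed cycle of length `n`: there are `n ≥ 1` distinct vertices
`c 0, …, c (n - 1)` with arcs `c 0 → c 1 → ⋯ → c (n - 1) → c 0` (indices are modulo `n`).
A loop is a cycle of length one. -/
def HasCycleOfLength {V : Type*} (D : Digraph V) (n : ℕ) : Prop :=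
  ∃ (_ : NeZero n) (c : Fin n → V), Function.Injective c ∧ ∀ i : Fin n, D.Adj (c i) (c (i + 1))

/-- The digraph obtained from `D` by removing the vertices of `W` together with all their
incident arcs. -/
def deleteVerts {V : Type*} (D : Digraph V) (W : Set V) : Digraph {v : V // v ∉ W} where
  Adj v w := D.Adj v.1 w.1

/-- `W` is a cycle transversal of `D`: the vertex-deleted digraph has no cycles. -/
def IsCycleTransversal {V : Type*} (D : Digraph V) (W : Set V) : Prop :=
  ∀ n : ℕ, ¬ HasCycleOfLength (deleteVerts D W) n

/-- `D` is the digraph of the nonnegative matrix `M`. -/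
def IsDigraphOf {V : Type*} (D : Digraph V) (M : Matrix V V ℝ≥0) : Prop :=
  ∀ v w : V, D.Adj v w ↔ M v w ≠ 0

/-- The principal submatrix of `M` with index set `F`, viewed as a complex matrix. -/
def principalSubmatrix {V : Type*} (M : Matrix V V ℝ≥0) (F : Finset V) : Matrix F F ℂ :=
  Matrix.of fun i j => ((M i.1 j.1 : ℝ) : ℂ)

open Classical in
/-- The intrinsic spectral radius `λ(M)`: the supremum of the spectral radii of the finite
principal submatrices of `M`. -/
noncomputable def intrinsicSpectralRadius {V : Type*} (M : Matrix V V ℝ≥0) : ℝ≥0∞ :=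
  ⨆ F : Finset V, spectralRadius ℂ (principalSubmatrix M F)

open Classical in
/-- The entries of the powers `M ^ p` of a possibly infinite nonnegative matrix, with values in
`[0, ∞]`. -/
noncomputable def matPow {V : Type*} (M : Matrix V V ℝ≥0) : ℕ → V → V → ℝ≥0∞
  | 0, v, w => if v = w then 1 else 0
  | p + 1, v, w => ∑' u : V, (M v u : ℝ≥0∞) * matPow M p u w

/-- A nonnegative matrix `M` with `λ(M) < ∞` is transient if the series `∑ M ^ p z ^ (-p)` is
entrywise convergent for `z = λ(M)`. -/
def IsTransient {V : Type*} (M : Matrix V V ℝ≥0) : Prop :=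
  intrinsicSpectralRadius M < ∞ ∧
    ∀ v w : V, ∑' p : ℕ, matPow M p v w / intrinsicSpectralRadius M ^ p < ∞

/-- The set `𝒯(D)` of all transient nonnegative matrices whose digraph is `D`. -/
def transientMatrices {V : Type*} (D : Digraph V) : Set (Matrix V V ℝ≥0) :=
  {M | IsDigraphOf D M ∧ IsTransient M}

end InfDigraph

/-! Suppose there is a finite transversal `W` and cycle lengths are bounded. A closed walk then
splits into short cycles that all meet `W`, so walks avoiding `W` have bounded length, and the
maximal length `d v` of such a walk from `v` is a bounded rank (`exists_rank`). If `M` were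
transient with `λ = λ(M)`, the sum `h` of its Green functions with targets in `W` would be positive
and finite, with `M h = λ h` off `W` and `M h = λ (h - 1)` on `W`. For `r > 1` close to 1, the
vector `h r ^ d` then satisfies `M (h r ^ d) ≤ (λ / r) h r ^ d`: off `W` because `d` drops along
arcs, on `W` because of the deficit. This forces `λ(M) ≤ λ / r < λ`, a contradiction.

If the criterion fails, some cycles have an arbitrarily small proportion of vertices in any given
finite set, so there is a sequence of cycles consisting mostly of new vertices. Put weight `q k → 1`
on the arcs leaving the new vertices of the `k`-th cycle, and add a small substochastic perturbation
that realises all of `D`. Every row sum stays strictly below 1, so `λ ≤ 1` and the series at 1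
converges; geometric means along the cycles give `λ ≥ (q k) ^ 2`, hence `λ = 1`. -/

namespace InfDigraph

/-! ### Upper and lower bounds for the intrinsic spectral radius -/

/-- A positive vector `h` with `M h ≤ c h` bounds the intrinsic spectral radius by `c`. -/
theorem intrinsicSpectralRadius_le_of_superharmonic {V : Type*} (M : Matrix V V ℝ≥0)
    (h : V → ℝ≥0) (hpos : ∀ v, 0 < h v) (c : ℝ≥0)
    (hM : ∀ v, ∑' u, (M v u : ℝ≥0∞) * h u ≤ c * h v) :
    intrinsicSpectralRadius M ≤ c := by
  classical
  unfold intrinsicSpectralRadius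
  refine iSup_le fun F => ?_
  refine iSup₂_le fun k hk => ?_
  have hk' : Module.End.HasEigenvalue (Matrix.toLin' (principalSubmatrix M F)) k := by
    rw [Module.End.hasEigenvalue_iff_mem_spectrum, Matrix.spectrum_toLin']
    convert hk
  obtain ⟨x, hx⟩ := hk'.exists_hasEigenvector
  have hx0 := hx.2
  have hxe : ∀ i, ∑ j, ((M i.1 j.1 : ℝ) : ℂ) * x j = k * x i := by
    intro i
    have := congrFun hx.apply_eq_smul i
    simpa [Matrix.toLin'_apply, Matrix.mulVec, dotProduct, principalSubmatrix] using this
  obtain ⟨i₀, hi₀⟩ := Function.ne_iff.1 hx0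
  -- Evaluate the eigenvalue equation where `|x| / h` is maximal.
  obtain ⟨i, -, hi⟩ := Finset.exists_max_image Finset.univ
    (fun i : F => ‖x i‖₊ / h i.1) ⟨i₀, Finset.mem_univ _⟩
  have hxi : 0 < ‖x i‖₊ := by
    have h1 := hi i₀ (Finset.mem_univ _)
    have h2 : 0 < ‖x i₀‖₊ / h i₀.1 := div_pos (by simpa using hi₀) (hpos _)
    exact pos_of_mul_pos_left (a := ‖x i‖₊) (b := (h i.1)⁻¹)
      (by simpa [div_eq_mul_inv] using h2.trans_le h1) (by positivity)
  have hrow : ∑ j : F, M i.1 j.1 * h j.1 ≤ c * h i.1 := by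
    have h1 := hM i.1
    have h2 : ∑ j ∈ F, (M i.1 j : ℝ≥0∞) * h j ≤ c * h i.1 := (ENNReal.sum_le_tsum F).trans h1
    rw [← Finset.sum_coe_sort F] at h2
    exact_mod_cast h2
  have key : ‖k‖₊ * ‖x i‖₊ ≤ c * ‖x i‖₊ := by
    calc ‖k‖₊ * ‖x i‖₊ = ‖∑ j, ((M i.1 j.1 : ℝ) : ℂ) * x j‖₊ := by rw [hxe, nnnorm_mul]
      _ ≤ ∑ j : F, M i.1 j.1 * ‖x j‖₊ := by
        refine (nnnorm_sum_le _ _).trans (Finset.sum_le_sum fun j _ => ?_)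
        rw [nnnorm_mul]
        simp
      _ ≤ ∑ j : F, M i.1 j.1 * (h j.1 * (‖x i‖₊ / h i.1)) := by
        gcongr with j
        have := hi j (Finset.mem_univ _)
        rwa [div_le_iff₀' (hpos _)] at this
      _ = (∑ j : F, M i.1 j.1 * h j.1) * (‖x i‖₊ / h i.1) := by
        rw [Finset.sum_mul]
        simp only [mul_assoc]
      _ ≤ c * h i.1 * (‖x i‖₊ / h i.1) := by gcongr
      _ = c * ‖x i‖₊ := by
        have := (hpos i.1).ne'
        field_simp
  exact_mod_cast le_of_mul_le_mul_right key hxi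

/-- Gelfand's formula bounds the spectral radius of a nonnegative matrix from below by the roots
of the diagonal entries of its powers. -/
theorem le_spectralRadius_of_pow_le {ι : Type*} [Fintype ι] [DecidableEq ι] (B : Matrix ι ι ℝ≥0)
    (A : Matrix ι ι ℂ) (hA : ∀ i j, A i j = ((B i j : ℝ) : ℂ)) (i : ι) (n : ℕ) (hn : 0 < n)
    (a : ℝ≥0) (ha : a ^ n ≤ (B ^ n) i i) : (a : ℝ≥0∞) ≤ spectralRadius ℂ A := by
  let : NormedRing (Matrix ι ι ℂ) := Matrix.linftyOpNormedRing
  let : NormedAlgebra ℂ (Matrix ι ι ℂ) := Matrix.linftyOpNormedAlgebra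
  have hAB : A = ((algebraMap ℝ ℂ).comp NNReal.toRealHom).mapMatrix B := by
    ext i j; simp [hA]
  have hent : ∀ m, (B ^ m) i i ≤ ‖A ^ m‖₊ := by
    intro m
    have h1 : (A ^ m) i i = (((B ^ m) i i : ℝ) : ℂ) := by
      rw [hAB, ← map_pow]; simp
    have h2 : ‖(A ^ m) i i‖₊ ≤ ‖A ^ m‖₊ := by
      rw [Matrix.linfty_opNNNorm_def]
      refine le_trans ?_ (Finset.le_sup (f := fun i => ∑ j, ‖(A ^ m) i j‖₊) (Finset.mem_univ i))
      exact Finset.single_le_sum (f := fun j => ‖(A ^ m) i j‖₊) (fun _ _ => zero_le)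
        (Finset.mem_univ i)
    rw [h1] at h2
    simpa using h2
  have hpow : ∀ k, a ^ (n * k) ≤ (B ^ (n * k)) i i := by
    intro k
    induction k with
    | zero => simp
    | succ k ih =>
      rw [mul_add, mul_one, pow_add, pow_add, Matrix.mul_apply]
      refine (mul_le_mul' ih ha).trans ?_
      exact Finset.single_le_sum (f := fun j => (B ^ (n * k)) i j * (B ^ n) j i)
        (fun _ _ => zero_le) (Finset.mem_univ i)
  have hT := spectrum.pow_nnnorm_pow_one_div_tendsto_nhds_spectralRadius A
  have hs : Filter.Tendsto (fun k => n * (k + 1)) Filter.atTop Filter.atTop :=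
    (Filter.tendsto_add_atTop_nat 1).const_mul_atTop' hn
  refine ge_of_tendsto' (hT.comp hs) fun k => ?_
  have h0 : ((n * (k + 1) : ℕ) : ℝ) ≠ 0 := by positivity
  have h1 : (a : ℝ≥0∞) ^ (n * (k + 1)) ≤ ‖A ^ (n * (k + 1))‖₊ := by
    exact_mod_cast (hpow (k + 1)).trans (hent _)
  calc (a : ℝ≥0∞) = ((a : ℝ≥0∞) ^ (n * (k + 1))) ^ (1 / ((n * (k + 1) : ℕ) : ℝ)) := by
        rw [← ENNReal.rpow_natCast, ← ENNReal.rpow_mul, mul_one_div_cancel h0, ENNReal.rpow_one]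
    _ ≤ _ := ENNReal.rpow_le_rpow h1 (by positivity)

/-- The geometric mean of the entries of `M` along a closed walk is a lower bound for `λ(M)`. -/
theorem le_intrinsicSpectralRadius_of_closed_walk {V : Type*} (M : Matrix V V ℝ≥0) (x : ℕ → V)
    (n : ℕ) (hn : 0 < n) (hx : x n = x 0) (a : ℝ≥0)
    (ha : a ^ n ≤ ∏ i ∈ Finset.range n, M (x i) (x (i + 1))) :
    (a : ℝ≥0∞) ≤ intrinsicSpectralRadius M := by
  classical
  let F : Finset V := (Finset.range (n + 1)).image x
  have hF : ∀ i, i ≤ n → x i ∈ F := fun i hi =>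
    Finset.mem_image_of_mem _ (Finset.mem_range.2 (by omega))
  let B : Matrix F F ℝ≥0 := Matrix.of fun i j => M i.1 j.1
  have hB : ∀ m (hm : m ≤ n), ∏ i ∈ Finset.range m, M (x i) (x (i + 1)) ≤
      (B ^ m) ⟨x 0, hF 0 (Nat.zero_le _)⟩ ⟨x m, hF m hm⟩ := by
    intro m
    induction m with
    | zero => intro _; simp
    | succ m ih =>
      intro hm
      rw [Finset.prod_range_succ, pow_succ, Matrix.mul_apply]
      refine (mul_le_mul_left (ih (by omega)) _).trans ?_
      exact Finset.single_le_sum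
        (f := fun j => (B ^ m) ⟨x 0, hF 0 (Nat.zero_le _)⟩ j * B j ⟨x (m + 1), hF _ hm⟩)
        (fun _ _ => zero_le) (Finset.mem_univ (⟨x m, hF m (by omega)⟩ : F))
  have h1 := ha.trans (hB n le_rfl)
  simp only [hx] at h1
  unfold intrinsicSpectralRadius
  refine le_iSup_of_le F ?_
  have := le_spectralRadius_of_pow_le B (principalSubmatrix M F) (fun _ _ => rfl) _ n hn a h1
  convert this

/-! ### Walks, their splitting into cycles, and the rank function -/

/-- `IsWalk D a l b`: there is a walk from `a` to `b` whose vertices, except the last one, are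
listed by `l`. -/
def IsWalk {V : Type*} (D : Digraph V) : V → List V → V → Prop
  | a, [], b => a = b
  | a, x :: t, b => a = x ∧ ∃ y, D.Adj x y ∧ IsWalk D y t b

theorem isWalk_append {V : Type*} {D : Digraph V} {l₁ l₂ : List V} {a b : V} :
    IsWalk D a (l₁ ++ l₂) b ↔ ∃ c, IsWalk D a l₁ c ∧ IsWalk D c l₂ b := by
  induction l₁ generalizing a with
  | nil => simp [IsWalk]
  | cons x t ih =>
    simp only [List.cons_append, IsWalk, ih]
    grind

theorem IsWalk.append {V : Type*} {D : Digraph V} {l₁ l₂ : List V} {a b c : V}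
    (h₁ : IsWalk D a l₁ c) (h₂ : IsWalk D c l₂ b) : IsWalk D a (l₁ ++ l₂) b :=
  isWalk_append.2 ⟨c, h₁, h₂⟩

theorem IsWalk.adj_getElem {V : Type*} {D : Digraph V} {l : List V} {a b : V}
    (h : IsWalk D a l b) (i : ℕ) (hi : i < l.length) :
    D.Adj l[i] ((l ++ [b])[i + 1]'(by simpa using hi)) := by
  induction l generalizing a i with
  | nil => simp at hi
  | cons x t ih =>
    obtain ⟨-, y, hxy, hw⟩ := h
    cases i with
    | zero =>
      cases t with
      | nil => simp only [IsWalk] at hw; subst hw; simpa using hxy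
      | cons z s => obtain ⟨rfl, -⟩ := hw; simpa using hxy
    | succ i => simpa using ih hw i (by simpa using hi)

theorem IsWalk.exists_cycle {V : Type*} {D : Digraph V} {l : List V} {a : V}
    (h : IsWalk D a l a) (hl : l ≠ []) (hnd : l.Nodup) :
    ∃ (_ : NeZero l.length), Function.Injective l.get ∧
      ∀ i : Fin l.length, D.Adj (l.get i) (l.get (i + 1)) := by
  have hpos : 0 < l.length := List.length_pos_iff.2 hl
  refine ⟨⟨hpos.ne'⟩, List.nodup_iff_injective_get.1 hnd, fun i => ?_⟩
  have hadj := h.adj_getElem i i.2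
  have : NeZero l.length := ⟨hpos.ne'⟩
  have h0 : l[0] = a := by
    cases l with
    | nil => simp at hl
    | cons x t => exact h.1.symm
  have hval : ((i + 1 : Fin l.length) : ℕ) = (i.1 + 1) % l.length := by
    simp [Fin.val_add]
  simp only [List.get_eq_getElem, hval]
  by_cases hi : i.1 + 1 < l.length
  · simp only [Nat.mod_eq_of_lt hi]
    rwa [List.getElem_append_left hi] at hadj
  · have hi' : i.1 + 1 = l.length := by omega
    simp only [hi', Nat.mod_self, h0]
    rw [List.getElem_append_right (by omega)] at hadj
    simpa using hadj

theorem exists_append_of_not_nodup {V : Type*} {l : List V} (h : ¬ l.Nodup) :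
    ∃ x l₁ l₂ l₃, l = l₁ ++ (x :: l₂ ++ x :: l₃) := by
  induction l with
  | nil => simp at h
  | cons y t ih =>
    by_cases hy : y ∈ t
    · obtain ⟨s, r, rfl⟩ := List.append_of_mem hy
      exact ⟨y, [], s, r, rfl⟩
    · obtain ⟨x, l₁, l₂, l₃, rfl⟩ := ih fun ht => h (List.nodup_cons.2 ⟨hy, ht⟩)
      exact ⟨x, y :: l₁, l₂, l₃, rfl⟩

open Classical in
/-- A closed walk splits into cycles, each of which is short and meets the transversal. -/
theorem IsWalk.length_le {V : Type*} {D : Digraph V} {W : Set V} (hW : IsCycleTransversal D W)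
    {L : ℕ} (hL : ∀ n, HasCycleOfLength D n → n ≤ L) {l : List V} {a : V}
    (h : IsWalk D a l a) : l.length ≤ L * l.countP (· ∈ W) := by
  induction hm : l.length using Nat.strong_induction_on generalizing l a with
  | _ m ih =>
  subst hm
  by_cases hl : l = []
  · simp [hl]
  by_cases hnd : l.Nodup
  · obtain ⟨hne, hinj, hadj⟩ := h.exists_cycle hl hnd
    have h1 : l.length ≤ L := hL _ ⟨hne, l.get, hinj, hadj⟩
    have h2 : 0 < l.countP (· ∈ W) := by
      by_contra h0
      have h0 : ∀ x ∈ l, x ∉ W := by simpa using h0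
      refine hW l.length ⟨hne, fun i => ⟨l.get i, h0 _ (List.get_mem _ _)⟩, ?_, hadj⟩
      intro i j hij
      exact hinj (congrArg Subtype.val hij)
    exact h1.trans (Nat.le_mul_of_pos_right _ h2)
  -- Cut at a repeated vertex into two shorter closed walks; both length and number of visits to `W`
  -- are additive.
  · obtain ⟨x, l₁, l₂, l₃, rfl⟩ := exists_append_of_not_nodup hnd
    obtain ⟨y, h₁, h₂⟩ := isWalk_append.1 h
    obtain rfl : y = x := h₂.1
    obtain ⟨z, h₂, h₃⟩ := isWalk_append.1 h₂
    obtain rfl : z = y := h₃.1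
    have i₁ := ih _ (by simp; omega) h₂ rfl
    have i₂ := ih _ (by simp) (h₁.append h₃) rfl
    simp only [List.length_append, List.countP_append, mul_add] at *
    omega

theorem exists_isWalk {V : Type*} {D : Digraph V} {a b : V}
    (h : Relation.ReflTransGen D.Adj a b) : ∃ l, IsWalk D a l b := by
  induction h using Relation.ReflTransGen.head_induction_on with
  | refl => exact ⟨[], rfl⟩
  | head hab _ ih =>
    obtain ⟨l, hl⟩ := ih
    exact ⟨_ :: l, rfl, _, hab, hl⟩

theorem exists_isWalk_first_visit {V : Type*} {D : Digraph V} {W : Set V} {a b : V}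
    (h : Relation.ReflTransGen D.Adj a b) (hb : b ∈ W) :
    ∃ w ∈ W, ∃ l, IsWalk D a l w ∧ ∀ x ∈ l, x ∉ W := by
  induction h using Relation.ReflTransGen.head_induction_on with
  | refl => exact ⟨b, hb, [], rfl, by simp⟩
  | @head a c hac _ ih =>
    by_cases ha : a ∈ W
    · exact ⟨a, ha, [], rfl, by simp⟩
    · obtain ⟨w, hw, l, hl, hlW⟩ := ih
      exact ⟨w, hw, a :: l, ⟨rfl, c, hac, hl⟩, by simpa [ha] using hlW⟩

-- The walk may start with its last visit to `W`, so the count is at most 1 rather than 0.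
open Classical in
theorem exists_isWalk_last_visit {V : Type*} {D : Digraph V} {W : Set V} {a b : V}
    (h : Relation.ReflTransGen D.Adj a b) (ha : a ∈ W) :
    ∃ w ∈ W, ∃ l, IsWalk D w l b ∧ l.countP (· ∈ W) ≤ 1 := by
  induction h with
  | refl => exact ⟨a, ha, [], rfl, by simp⟩
  | @tail b c _ hbc ih =>
    by_cases hb : b ∈ W
    · exact ⟨b, hb, [b], ⟨rfl, c, hbc, rfl⟩, by simp [hb]⟩
    · obtain ⟨w, hw, l, hl, hlW⟩ := ih
      exact ⟨w, hw, l ++ [b], hl.append ⟨rfl, c, hbc, rfl⟩, by simpa [hb] using hlW⟩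

/-- If all cycles are short, then all walks avoiding a finite cycle transversal are short. -/
theorem exists_length_bound {V : Type*} {D : Digraph V}
    (hD : ∀ v w, Relation.ReflTransGen D.Adj v w) {W : Set V} (hfin : W.Finite)
    (hW : IsCycleTransversal D W) {L : ℕ} (hL : ∀ n, HasCycleOfLength D n → n ≤ L)
    (hne : W.Nonempty) :
    ∃ K : ℕ, ∀ a l b, IsWalk D a l b → (∀ x ∈ l, x ∉ W) → l.length ≤ K := by
  classical
  obtain ⟨w₀, hw₀⟩ := hne
  choose p hp using fun v => exists_isWalk (hD v w₀)
  choose q hq using fun v => exists_isWalk (hD w₀ v)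
  obtain ⟨A, hA⟩ := (hfin.image fun w => (p w).length).bddAbove
  obtain ⟨B, hB⟩ := (hfin.image fun w => (q w).length).bddAbove
  -- Close the walk up through `w₀`: at most `B` visits to `W` on the way from `w₀` to `w'`, one on
  -- leaving `w'`, none from `a` to `w`, and at most `A` on the way back to `w₀`.
  refine ⟨L * (A + B + 1), fun a l b hl hlW => ?_⟩
  obtain ⟨w, hw, l₁, hl₁, hlW₁⟩ := exists_isWalk_first_visit (hD b w₀) hw₀
  obtain ⟨w', hw', l₂, hl₂, hlW₂⟩ := exists_isWalk_last_visit (hD w₀ a) hw₀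
  have hclosed := ((((hq w').append hl₂).append hl).append hl₁).append (hp w)
  have hlen := hclosed.length_le hW hL
  have c1 : l.countP (· ∈ W) = 0 := by simpa using hlW
  have c2 : l₁.countP (· ∈ W) = 0 := by simpa using hlW₁
  have c3 : (p w).countP (· ∈ W) ≤ A := List.countP_le_length.trans (hA ⟨w, hw, rfl⟩)
  have c4 : (q w').countP (· ∈ W) ≤ B := List.countP_le_length.trans (hB ⟨w', hw', rfl⟩)
  rw [List.countP_append, List.countP_append, List.countP_append, List.countP_append] at hlen
  calc l.length ≤ _ := by simp only [List.length_append]; omega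
    _ ≤ _ := hlen
    _ ≤ L * (A + B + 1) := Nat.mul_le_mul_left _ (by omega)

theorem reflTransGen_of_isStrong {V : Type*} {D : Digraph V} (h : IsStrong D) (v w : V) :
    Relation.ReflTransGen D.Adj v w := by
  by_cases hvw : v = w
  · exact hvw ▸ .refl
  · exact h v w hvw

/-- A rank function that decreases along arcs leaving vertices outside a finite transversal. -/
theorem exists_rank {V : Type*} {D : Digraph V}
    (hD : ∀ v w, Relation.ReflTransGen D.Adj v w) {W : Set V} (hfin : W.Finite)
    (hW : IsCycleTransversal D W) {L : ℕ} (hL : ∀ n, HasCycleOfLength D n → n ≤ L)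
    (hne : W.Nonempty) :
    ∃ (K : ℕ) (d : V → ℕ), (∀ v, d v ≤ K) ∧ (∀ v ∈ W, d v = 0) ∧
      ∀ v u, v ∉ W → D.Adj v u → d u + 1 ≤ d v := by
  obtain ⟨K, hK⟩ := exists_length_bound hD hfin hW hL hne
  let S : V → Set ℕ := fun v => {n | ∃ l b, IsWalk D v l b ∧ (∀ x ∈ l, x ∉ W) ∧ l.length = n}
  have hS : ∀ v, K ∈ upperBounds (S v) := by
    rintro v n ⟨l, b, hl, hlW, rfl⟩
    exact hK v l b hl hlW
  have hS0 : ∀ v, (S v).Nonempty := fun v => ⟨0, [], v, rfl, by simp, rfl⟩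
  refine ⟨K, fun v => sSup (S v), fun v => csSup_le (hS0 v) (hS v), fun v hv => ?_,
    fun v u hv hvu => ?_⟩
  · refine Nat.le_zero.1 (csSup_le (hS0 v) ?_)
    rintro n ⟨l, b, hl, hlW, rfl⟩
    cases l with
    | nil => simp
    | cons x t => exact absurd (hl.1 ▸ hv) (hlW x (by simp))
  · obtain ⟨l, b, hl, hlW, hn⟩ := Nat.sSup_mem (hS0 u) ⟨K, hS u⟩
    refine le_csSup ⟨K, hS v⟩ ⟨v :: l, b, ⟨rfl, u, hvu, hl⟩, by simpa [hv] using hlW, ?_⟩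
    simp [hn]

/-! ### Green functions and the absence of transient matrices -/

theorem exists_matPow_ne_zero {V : Type*} {D : Digraph V} {M : Matrix V V ℝ≥0}
    (hM : IsDigraphOf D M) {v w : V} (h : Relation.ReflTransGen D.Adj v w) :
    ∃ p, matPow M p v w ≠ 0 := by
  induction h using Relation.ReflTransGen.head_induction_on with
  | refl => exact ⟨0, by simp [matPow]⟩
  | @head a c hac _ ih =>
    obtain ⟨p, hp⟩ := ih
    refine ⟨p + 1, fun h0 => ?_⟩
    rw [matPow, ENNReal.tsum_eq_zero] at h0
    have := h0 c
    simp [hp, (hM a c).1 hac] at this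

/-- The Green function `∑ M ^ p c ^ (-p)` of a nonnegative matrix. -/
noncomputable def green {V : Type*} (M : Matrix V V ℝ≥0) (c : ℝ≥0∞) (v w : V) : ℝ≥0∞ :=
  ∑' p : ℕ, matPow M p v w / c ^ p

-- Splitting off the term `p = 0` gives `c G = c I + M G`, written without subtraction so that it
-- makes sense in `[0, ∞]`.
open Classical in
theorem green_eq {V : Type*} (M : Matrix V V ℝ≥0) {c : ℝ≥0∞} (hc : c ≠ 0) (hc' : c ≠ ∞)
    (v w : V) :
    c * green M c v w = c * (if v = w then 1 else 0) + ∑' u, (M v u : ℝ≥0∞) * green M c u w := by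
  unfold green
  rw [tsum_eq_zero_add' ENNReal.summable, mul_add, ← ENNReal.tsum_mul_left]
  congr 1
  · simp [matPow]
  · simp_rw [← ENNReal.tsum_mul_left]
    rw [ENNReal.tsum_comm]
    refine tsum_congr fun p => ?_
    rw [matPow, div_eq_mul_inv, ← ENNReal.tsum_mul_right, ← ENNReal.tsum_mul_left]
    refine tsum_congr fun u => ?_
    rw [div_eq_mul_inv, pow_succ, ENNReal.mul_inv (.inr hc') (.inr hc)]
    calc c * ((M v u : ℝ≥0∞) * matPow M p u w * ((c ^ p)⁻¹ * c⁻¹))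
        = (c * c⁻¹) * ((M v u : ℝ≥0∞) * (matPow M p u w * (c ^ p)⁻¹)) := by ring
      _ = _ := by rw [ENNReal.mul_inv_cancel hc hc', one_mul]

/-- On `[1, H]` the ratio `(x - 1) / x` stays away from 1, which leaves room for a factor `r ^ K`
near 1. It is applied to the values of `h` on `W`. -/
theorem exists_one_lt_pow_mul_le (K : ℕ) (H : ℝ) (hH : 0 < H) :
    ∃ r : ℝ≥0, 1 < r ∧ ∀ x : ℝ, 1 ≤ x → x ≤ H → (r : ℝ) ^ K * (x - 1) ≤ x := by
  have hc : Filter.Tendsto (fun r : ℝ≥0 => (r : ℝ) ^ K) (nhdsWithin 1 (Set.Ioi 1)) (nhds 1) := by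
    have : Continuous fun r : ℝ≥0 => (r : ℝ) ^ K := by fun_prop
    simpa using (this.tendsto 1).mono_left nhdsWithin_le_nhds
  have h1 : (1 : ℝ) < 1 + 1 / H := by simpa using hH
  obtain ⟨r, hr, hr1⟩ := ((hc.eventually (gt_mem_nhds h1)).and self_mem_nhdsWithin).exists
  refine ⟨r, hr1, fun x hx hxH => ?_⟩
  calc (r : ℝ) ^ K * (x - 1) ≤ (1 + 1 / H) * (x - 1) :=
        mul_le_mul_of_nonneg_right hr.le (by linarith)
    _ ≤ x := by
        have : 1 / H * (x - 1) ≤ 1 := by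
          rw [one_div, inv_mul_le_iff₀ hH]; linarith
        linarith

theorem not_isTransient {V : Type*} {D : Digraph V} (hstrong : IsStrong D)
    (harc : ∃ v w : V, D.Adj v w) {W : Set V} (hfin : W.Finite) (hW : IsCycleTransversal D W)
    {L : ℕ} (hL : ∀ n, HasCycleOfLength D n → n ≤ L) {M : Matrix V V ℝ≥0}
    (hM : IsDigraphOf D M) : ¬ IsTransient M := by
  classical
  rintro ⟨hlt, hG⟩
  have hD := reflTransGen_of_isStrong hstrong
  obtain ⟨v₀, v₁, harc⟩ := harc
  have hne : W.Nonempty := by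
    obtain ⟨l, hl⟩ := exists_isWalk (hD v₁ v₀)
    have hl' : IsWalk D v₀ (v₀ :: l) v₀ := ⟨rfl, v₁, harc, hl⟩
    have h1 := hl'.length_le hW hL
    by_contra h0
    rw [Set.not_nonempty_iff_eq_empty] at h0
    simp [h0] at h1
  generalize hlam : intrinsicSpectralRadius M = lam at hlt hG
  have hlam' : lam ≠ ∞ := hlt.ne
  -- In `[0, ∞]` a nonzero number divided by 0 is `∞`, so a nonzero power of positive exponent would
  -- make the series diverge at `λ = 0`.
  have hlam0 : lam ≠ 0 := by
    rintro rfl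
    obtain ⟨p, hp⟩ := exists_matPow_ne_zero hM (hD v₁ v₀)
    have h1 : matPow M (p + 1) v₀ v₀ ≠ 0 := fun h0 => by
      rw [matPow, ENNReal.tsum_eq_zero] at h0
      have := h0 v₁
      simp [hp, (hM _ _).1 harc] at this
    have h2 := (ENNReal.le_tsum (f := fun p => matPow M p v₀ v₀ / 0 ^ p) (p + 1)).trans_lt
      (hG v₀ v₀)
    simp [ENNReal.div_zero h1] at h2
  obtain ⟨K, d, hdK, hdW, hd⟩ := exists_rank hD hfin hW hL hne
  let h : V → ℝ≥0∞ := fun v => ∑ w ∈ hfin.toFinset, green M lam v w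
  have hfinite : ∀ v, h v ≠ ∞ := fun v =>
    (ENNReal.sum_lt_top.2 fun w _ => hG v w).ne
  have hpos : ∀ v, h v ≠ 0 := by
    intro v h0
    obtain ⟨w, hw⟩ := hne
    have h1 : green M lam v w = 0 := by
      simpa using (Finset.sum_eq_zero_iff.1 h0) w (by simpa using hw)
    obtain ⟨p, hp⟩ := exists_matPow_ne_zero hM (hD v w)
    have h2 := ENNReal.tsum_eq_zero.1 h1 p
    rw [ENNReal.div_eq_zero_iff] at h2
    exact h2.elim hp (ENNReal.pow_ne_top hlam')
  have hharm : ∀ v, lam * h v = lam * (if v ∈ W then 1 else 0) + ∑' u, (M v u : ℝ≥0∞) * h u := by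
    intro v
    simp only [h, Finset.mul_sum]
    rw [Summable.tsum_finsetSum fun _ _ => ENNReal.summable]
    simp_rw [green_eq M hlam0 hlam' v]
    rw [Finset.sum_add_distrib, ← Finset.mul_sum]
    simp
  lift lam to ℝ≥0 using hlam'
  lift h to V → ℝ≥0 using hfinite with g hg
  obtain ⟨H, hH⟩ := (hfin.image fun w => (g w : ℝ)).bddAbove
  -- In `K + 1`, the `K` absorbs `r ^ d u` and the extra factor comes from `lam / r`.
  obtain ⟨r, hr1, hr⟩ := exists_one_lt_pow_mul_le (K + 1) (max H 1) (by positivity)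
  have hlt' : lam / r < lam := by
    have : 0 < lam := by simpa [pos_iff_ne_zero] using hlam0
    exact (div_lt_iff₀ (zero_lt_one.trans hr1)).2 (lt_mul_of_one_lt_right this hr1)
  have hr0 : r ≠ 0 := (zero_lt_one.trans hr1).ne'
  have hle := intrinsicSpectralRadius_le_of_superharmonic M (fun v => g v * r ^ d v)
    (fun v => by
      have := hpos v
      have : 0 < g v := by simpa [pos_iff_ne_zero] using this
      positivity) (lam / r) ?_
  · rw [hlam] at hle
    exact absurd (by exact_mod_cast hle) hlt'.not_ge
  intro v
  have hv := hharm v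
  -- On `W` the rank is 0 and the deficit `lam` pays for the growth of `r ^ d`; off `W` the drop of
  -- `d` along arcs gains the factor `r`.
  by_cases hvW : v ∈ W
  · simp only [hvW, if_true, mul_one] at hv
    have hT : ∑' u, (M v u : ℝ≥0∞) * g u ≠ ∞ := by
      intro h0
      rw [h0] at hv
      simp [ENNReal.mul_eq_top] at hv
    have hle1 : ∑' u, (M v u : ℝ≥0∞) * ((g u * r ^ d u : ℝ≥0) : ℝ≥0∞) ≤
        r ^ K * ∑' u, (M v u : ℝ≥0∞) * g u := by
      rw [← ENNReal.tsum_mul_left]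
      refine ENNReal.tsum_le_tsum fun u => ?_
      have : M v u * (g u * r ^ d u) ≤ r ^ K * (M v u * g u) := by
        calc M v u * (g u * r ^ d u) = r ^ d u * (M v u * g u) := by ring
          _ ≤ _ := by gcongr; exacts [hr1.le, hdK u]
      exact_mod_cast this
    refine hle1.trans ?_
    generalize ∑' u, (M v u : ℝ≥0∞) * g u = T at hv hT
    lift T to ℝ≥0 using hT
    have hv' : lam * g v = lam + T := by exact_mod_cast hv
    have hl0 : (0 : ℝ) < lam := by
      have : 0 < lam := by simpa [pos_iff_ne_zero] using hlam0
      exact_mod_cast this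
    have hvr : (T : ℝ) = lam * (g v - 1) := by
      have : (lam : ℝ) * g v = lam + T := by exact_mod_cast hv'
      linarith
    have hg1 : (1 : ℝ) ≤ g v := by
      have := T.2
      change 0 ≤ (T : ℝ) at this
      rw [hvr] at this
      linarith [nonneg_of_mul_nonneg_right this hl0]
    have := hr (g v) hg1 ((hH ⟨v, hvW, rfl⟩).trans (le_max_left _ _))
    have hfin : r ^ K * T ≤ lam / r * (g v * r ^ d v) := by
      rw [hdW v hvW, pow_zero, mul_one, div_mul_eq_mul_div, le_div_iff₀ (by positivity)]
      rw [← NNReal.coe_le_coe]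
      push_cast
      rw [hvr]
      calc (r : ℝ) ^ K * (lam * (g v - 1)) * r = lam * (r ^ (K + 1) * (g v - 1)) := by ring
        _ ≤ lam * g v := by gcongr
    exact_mod_cast hfin
  · simp only [hvW, if_false, mul_zero, zero_add] at hv
    have hle1 : (r : ℝ≥0∞) * ∑' u, (M v u : ℝ≥0∞) * ((g u * r ^ d u : ℝ≥0) : ℝ≥0∞) ≤
        r ^ d v * ∑' u, (M v u : ℝ≥0∞) * g u := by
      rw [← ENNReal.tsum_mul_left, ← ENNReal.tsum_mul_left]
      refine ENNReal.tsum_le_tsum fun u => ?_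
      have : r * (M v u * (g u * r ^ d u)) ≤ r ^ d v * (M v u * g u) := by
        by_cases hz : M v u = 0
        · simp [hz]
        calc r * (M v u * (g u * r ^ d u)) = r ^ (d u + 1) * (M v u * g u) := by ring
          _ ≤ _ := by gcongr; exacts [hr1.le, hd v u hvW ((hM v u).2 hz)]
      exact_mod_cast this
    rw [← hv] at hle1
    have hr0' : (r : ℝ≥0∞) ≠ 0 := by simpa using hr0
    rw [← ENNReal.mul_le_mul_iff_right hr0' ENNReal.coe_ne_top]
    refine hle1.trans (le_of_eq ?_)
    have : r ^ d v * (lam * g v) = r * (lam / r * (g v * r ^ d v)) := by field_simp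
    exact_mod_cast this

/-! ### Cycles with few old vertices -/

/-- The directed cycles of `D`. -/
structure Cycle {V : Type*} (D : Digraph V) where
  /-- The length of the cycle. -/
  length : ℕ
  neZero : NeZero length
  /-- The vertices of the cycle, in cyclic order. -/
  vert : Fin length → V
  injective : Function.Injective vert
  adj : ∀ i, D.Adj (vert i) (vert (i + 1))

attribute [instance] Cycle.neZero

open Classical in
/-- The indicator of the arcs of a cycle. -/
noncomputable def Cycle.arc {V : Type*} {D : Digraph V} (C : Cycle D) (v u : V) : ℝ≥0 :=
  if ∃ i, C.vert i = v ∧ C.vert (i + 1) = u then 1 else 0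

theorem Cycle.arc_vert {V : Type*} {D : Digraph V} (C : Cycle D) (i : Fin C.length) :
    C.arc (C.vert i) (C.vert (i + 1)) = 1 := by
  rw [Cycle.arc, if_pos ⟨i, rfl, rfl⟩]

theorem Cycle.adj_of_arc_ne_zero {V : Type*} {D : Digraph V} (C : Cycle D) {v u : V}
    (h : C.arc v u ≠ 0) : D.Adj v u := by
  by_contra hvu
  refine h (if_neg ?_)
  rintro ⟨i, rfl, rfl⟩
  exact hvu (C.adj i)

/-- By injectivity a vertex on the cycle has a single successor there. -/
theorem Cycle.tsum_arc_le {V : Type*} {D : Digraph V} (C : Cycle D) (v : V) :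
    ∑' u, (C.arc v u : ℝ≥0∞) ≤ 1 := by
  by_cases hv : ∃ i, C.vert i = v
  · obtain ⟨i, rfl⟩ := hv
    rw [tsum_eq_single (C.vert (i + 1)), C.arc_vert]
    · simp
    · intro u hu
      rw [Cycle.arc, if_neg]
      · simp
      · rintro ⟨j, hj, rfl⟩
        exact hu (by rw [C.injective hj])
  · rw [ENNReal.tsum_eq_zero.2 fun u => ?_]
    · exact zero_le
    · rw [Cycle.arc, if_neg]
      · simp
      · rintro ⟨j, hj, -⟩
        exact hv ⟨j, hj⟩

open Classical in
/-- Cycles with an arbitrarily small proportion of vertices in a given finite set. -/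
theorem exists_cycle_mul_card_le {V : Type*} {D : Digraph V}
    (h : ¬ ((∃ W : Set V, W.Finite ∧ IsCycleTransversal D W) ∧
      ∃ L : ℕ, ∀ n : ℕ, HasCycleOfLength D n → n ≤ L)) (S : Finset V) (N : ℕ) :
    ∃ C : Cycle D, N * (Finset.univ.filter fun i => C.vert i ∈ S).card ≤ C.length := by
  rw [not_and_or] at h
  rcases h with h | h
  · have hS : ¬ IsCycleTransversal D (S : Set V) := fun hS => h ⟨S, S.finite_toSet, hS⟩
    simp only [IsCycleTransversal, not_forall, not_not] at hS
    obtain ⟨n, hn, c, hc, hadj⟩ := hS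
    refine ⟨⟨n, hn, fun i => (c i).1, fun i j hij => hc (Subtype.ext hij), hadj⟩, ?_⟩
    rw [Finset.filter_false_of_mem fun i _ => by simpa using (c i).2]
    simp
  -- A cycle longer than `N * S.card` meets `S` at most `S.card` times.
  · push Not at h
    obtain ⟨n, ⟨hn, c, hc, hadj⟩, hlt⟩ := h (N * S.card)
    refine ⟨⟨n, hn, c, hc, hadj⟩, le_trans (Nat.mul_le_mul_left _ ?_) hlt.le⟩
    exact Finset.card_le_card_of_injOn c (by intro i; simp) hc.injOn

open Classical in
/-- A sequence of cycles, each of which has a prescribed small proportion of vertices on the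
preceding ones. -/
theorem exists_cycle_sequence {V : Type*} {D : Digraph V}
    (h : ∀ (S : Finset V) (N : ℕ), ∃ C : Cycle D,
      N * (Finset.univ.filter fun i => C.vert i ∈ S).card ≤ C.length) (N : ℕ → ℕ) :
    ∃ C : ℕ → Cycle D, ∀ k, N k * (Finset.univ.filter fun i =>
      ∃ j < k, (C k).vert i ∈ Set.range (C j).vert).card ≤ (C k).length := by
  choose next hnext using h
  -- `S k` collects the vertices of the first `k` cycles.
  obtain ⟨S, hS⟩ : ∃ S : ℕ → Finset V, ∀ k,
      S (k + 1) = S k ∪ Finset.univ.image (next (S k) (N k)).vert :=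
    ⟨fun k => Nat.rec ∅ (fun k s => s ∪ Finset.univ.image (next s (N k)).vert) k, fun k => rfl⟩
  have hmono : Monotone S := monotone_nat_of_le_succ fun k => by
    rw [hS]
    exact Finset.subset_union_left
  have hmem : ∀ j k, j < k → ∀ l, (next (S j) (N j)).vert l ∈ S k := fun j k hj l => by
    refine hmono (Nat.succ_le_of_lt hj) ?_
    rw [hS]
    exact Finset.mem_union_right _ (Finset.mem_image_of_mem _ (Finset.mem_univ l))
  refine ⟨fun k => next (S k) (N k), fun k => ?_⟩
  refine le_trans (Nat.mul_le_mul_left _ (Finset.card_le_card fun i hi => ?_)) (hnext (S k) (N k))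
  obtain ⟨j, hj, l, hl⟩ := (Finset.mem_filter.1 hi).2
  exact Finset.mem_filter.2 ⟨Finset.mem_univ i, hl ▸ hmem j k hj l⟩

/-! ### Construction of a transient matrix -/

/-- A substochastic matrix with digraph `D` that dominates positive multiples of the indicators of
the cycles in a sequence. -/
theorem exists_substochastic {V : Type*} [Countable V] {D : Digraph V} (C : ℕ → Cycle D)
    (ε : ℕ → ℝ≥0) (hε : ∑' k, (ε k : ℝ≥0∞) ≤ 2⁻¹) :
    ∃ Q : Matrix V V ℝ≥0, IsDigraphOf D Q ∧ (∀ v, ∑' u, (Q v u : ℝ≥0∞) ≤ 1) ∧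
      ∀ k v u, ε k * (C k).arc v u ≤ Q v u := by
  classical
  -- The weights `e` make every arc of `D` present at a cost of at most 1/2 per row; the cycles use
  -- the other half.
  obtain ⟨e, he0, he⟩ := ENNReal.exists_pos_sum_of_countable (ε := 2⁻¹) (by simp) V
  let R : V → V → ℝ≥0∞ := fun v u =>
    ∑' k, (ε k : ℝ≥0∞) * (C k).arc v u + if D.Adj v u then (e u : ℝ≥0∞) else 0
  have hR : ∀ v, ∑' u, R v u ≤ 1 := by
    intro v
    simp only [R]
    rw [ENNReal.tsum_add, ENNReal.tsum_comm, ← ENNReal.inv_two_add_inv_two]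
    refine add_le_add ((ENNReal.tsum_le_tsum fun k => ?_).trans hε)
      ((ENNReal.tsum_le_tsum fun u => ?_).trans he.le)
    · rw [ENNReal.tsum_mul_left]
      exact mul_le_of_le_one_right' ((C k).tsum_arc_le v)
    · split_ifs <;> simp
  have hRtop : ∀ v u, R v u ≠ ∞ := fun v u =>
    ((ENNReal.le_tsum u).trans (hR v)).trans_lt ENNReal.one_lt_top |>.ne
  refine ⟨fun v u => (R v u).toNNReal, fun v u => ?_, fun v => ?_, fun k v u => ?_⟩
  · rw [Ne, ENNReal.toNNReal_eq_zero_iff, not_or]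
    refine ⟨fun h => ⟨fun h0 => ?_, hRtop v u⟩, fun h => ?_⟩
    · have := (add_eq_zero.1 h0).2
      rw [if_pos h] at this
      exact (he0 u).ne' (by exact_mod_cast this)
    · by_contra hvu
      refine h.1 ?_
      have : ∀ k, (C k).arc v u = 0 := fun k => by
        by_contra h0
        exact hvu ((C k).adj_of_arc_ne_zero h0)
      simp [R, hvu, this]
  · simp_rw [ENNReal.coe_toNNReal (hRtop v _)]
    exact hR v
  · rw [← ENNReal.coe_le_coe, ENNReal.coe_toNNReal (hRtop v u)]
    refine le_trans ?_ (le_self_add)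
    push_cast
    exact ENNReal.le_tsum (f := fun k => (ε k : ℝ≥0∞) * (C k).arc v u) k

/-- View `M` as a chain killed at `v` with probability at least `δ v`: the expected number of visits
to `w` times `δ w` is at most the probability of dying at `w`. The induction is on the number of
steps. -/
theorem tsum_matPow_lt_top {V : Type*} {M : Matrix V V ℝ≥0} {δ : V → ℝ≥0} (hδ : ∀ v, 0 < δ v)
    (hM : ∀ v, δ v + ∑' u, (M v u : ℝ≥0∞) ≤ 1) (v w : V) : ∑' p, matPow M p v w < ∞ := by
  classical
  have key : ∀ N v, (∑ p ∈ Finset.range N, matPow M p v w) * δ w ≤ 1 := by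
    intro N
    induction N with
    | zero => simp
    | succ N ih =>
      intro v
      rw [Finset.sum_range_succ', add_mul, add_comm]
      refine (add_le_add ?_ ?_).trans (hM v)
      · by_cases hvw : v = w
        · simp [matPow, hvw]
        · simp [matPow, hvw]
      · simp only [matPow]
        rw [← Summable.tsum_finsetSum fun _ _ => ENNReal.summable, ← ENNReal.tsum_mul_right]
        refine ENNReal.tsum_le_tsum fun u => ?_
        rw [← Finset.mul_sum, mul_assoc]
        exact mul_le_of_le_one_right' (ih u)
  refine lt_of_le_of_lt (b := (δ w : ℝ≥0∞)⁻¹) ?_ (by simpa using hδ w)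
  rw [ENNReal.tsum_eq_iSup_nat]
  exact iSup_le fun N => (ENNReal.le_inv_iff_mul_le).2 (key N v)

theorem Cycle.le_intrinsicSpectralRadius {V : Type*} {D : Digraph V} (C : Cycle D)
    (M : Matrix V V ℝ≥0) (a : ℝ≥0)
    (ha : a ^ C.length ≤ ∏ i, M (C.vert i) (C.vert (i + 1))) :
    (a : ℝ≥0∞) ≤ intrinsicSpectralRadius M := by
  refine le_intrinsicSpectralRadius_of_closed_walk M (fun i => C.vert (Fin.ofNat C.length i))
    C.length (Nat.pos_of_ne_zero C.neZero.out) (by simp) a ?_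
  rw [Finset.prod_range]
  refine ha.trans (le_of_eq (Finset.prod_congr rfl fun i _ => ?_))
  have h1 : Fin.ofNat C.length i = i := by ext; simp
  have h2 : Fin.ofNat C.length (i + 1) = i + 1 := by ext; simp [Fin.val_add]
  rw [h1, h2]

theorem exists_isTransient {V : Type*} [Countable V] {D : Digraph V}
    (h : ¬ ((∃ W : Set V, W.Finite ∧ IsCycleTransversal D W) ∧
      ∃ L : ℕ, ∀ n : ℕ, HasCycleOfLength D n → n ≤ L)) :
    ∃ M : Matrix V V ℝ≥0, IsDigraphOf D M ∧ IsTransient M := by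
  classical
  obtain ⟨ε, hε0, hε⟩ := ENNReal.exists_pos_sum_of_countable (ε := 2⁻¹) (by simp) ℕ
  let δ : ℕ → ℝ≥0 := fun k => 1 / (k + 2)
  let q : ℕ → ℝ≥0 := fun k => (k + 1) / (k + 2)
  have hqδ : ∀ k, q k + δ k = 1 := fun k => by
    simp only [q, δ]
    rw [← add_div, add_assoc, one_add_one_eq_two, div_self (by positivity)]
  have hδ0 : ∀ k, 0 < δ k := fun k => by positivity
  have hδ : Antitone δ := fun j k hjk => by
    simp only [δ]
    gcongr
  have hq1 : ∀ k, q k < 1 := fun k => by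
    rw [← hqδ k]; exact lt_add_of_pos_right _ (hδ0 k)
  -- `q k ^ N k` lies below the weight that the perturbation alone guarantees on the arcs of the
  -- `k`-th cycle.
  choose N hN using fun k => exists_pow_lt_of_lt_one
    (mul_pos (half_pos (hδ0 k)) (hε0 k)) (hq1 k)
  obtain ⟨C, hC⟩ := exists_cycle_sequence (exists_cycle_mul_card_le h) N
  obtain ⟨Q, hQD, hQ1, hQ⟩ := exists_substochastic C ε hε.le
  -- The first cycle through `v`. If there is none, the value is 0 and the arc term of the row
  -- vanishes.
  let f : V → ℕ := fun v => sInf {k | v ∈ Set.range (C k).vert}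
  let M : Matrix V V ℝ≥0 := fun v u => q (f v) * (C (f v)).arc v u + δ (f v) / 2 * Q v u
  have hMD : IsDigraphOf D M := by
    intro v u
    refine ⟨fun hvu => ?_, fun hvu => ?_⟩
    · have h1 : 0 < Q v u := pos_iff_ne_zero.2 ((hQD v u).1 hvu)
      exact (add_pos_of_nonneg_of_pos zero_le (mul_pos (half_pos (hδ0 _)) h1)).ne'
    · by_contra h0
      have h1 : Q v u = 0 := by
        by_contra h1
        exact h0 ((hQD v u).2 h1)
      have h2 : (C (f v)).arc v u = 0 := by
        by_contra h2
        exact h0 ((C (f v)).adj_of_arc_ne_zero h2)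
      simp [M, h1, h2] at hvu
  have hrow : ∀ v, ((δ (f v) / 2 : ℝ≥0) : ℝ≥0∞) + ∑' u, (M v u : ℝ≥0∞) ≤ 1 := by
    intro v
    have h1 : ∑' u, (M v u : ℝ≥0∞) ≤ q (f v) + (δ (f v) / 2 : ℝ≥0) := by
      simp only [M, ENNReal.coe_add, ENNReal.coe_mul]
      rw [ENNReal.tsum_add, ENNReal.tsum_mul_left, ENNReal.tsum_mul_left]
      exact add_le_add (mul_le_of_le_one_right' ((C _).tsum_arc_le v))
        (mul_le_of_le_one_right' (hQ1 v))
    refine (add_le_add_right h1 _).trans (le_of_eq ?_)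
    have h2 : δ (f v) / 2 + (q (f v) + δ (f v) / 2) = 1 := by
      rw [add_left_comm, add_halves, hqδ]
    exact_mod_cast h2
  have hle : intrinsicSpectralRadius M ≤ 1 := by
    refine intrinsicSpectralRadius_le_of_superharmonic M (fun _ => 1) (fun _ => one_pos) 1
      fun v => ?_
    simpa using le_add_self.trans (hrow v)
  -- A new vertex contributes at least `q k`; at an old one the perturbation suffices, since `δ` is
  -- antitone and `f v ≤ k`.
  have hterm : ∀ k (i : Fin (C k).length),
      q k * (if ∃ j < k, (C k).vert i ∈ Set.range (C j).vert then q k ^ N k else 1) ≤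
        M ((C k).vert i) ((C k).vert (i + 1)) := by
    intro k i
    set v := (C k).vert i with hv
    have hmem : k ∈ {k | v ∈ Set.range (C k).vert} := ⟨i, rfl⟩
    have hfk : f v ≤ k := Nat.sInf_le hmem
    have hfv : v ∈ Set.range (C (f v)).vert :=
      Nat.sInf_mem (s := {k | v ∈ Set.range (C k).vert}) ⟨k, hmem⟩
    split_ifs with hif
    · calc q k * q k ^ N k ≤ q k ^ N k := mul_le_of_le_one_left' (hq1 k).le
        _ ≤ δ k / 2 * ε k := (hN k).le
        _ ≤ δ (f v) / 2 * (ε k * (C k).arc v ((C k).vert (i + 1))) := by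
          rw [(C k).arc_vert, mul_one]
          have := hδ hfk
          gcongr
        _ ≤ δ (f v) / 2 * Q v ((C k).vert (i + 1)) := by gcongr; exact hQ _ _ _
        _ ≤ _ := le_add_self
    · have hfk' : f v = k := by
        by_contra hne
        exact hif ⟨f v, lt_of_le_of_ne hfk hne, hfv⟩
      have : M v ((C k).vert (i + 1)) = q k + δ k / 2 * Q v ((C k).vert (i + 1)) := by
        simp only [M, hfk']
        rw [(C k).arc_vert, mul_one]
      rw [this, mul_one]
      exact le_self_add
  have hcycle : ∀ k, ((q k * q k : ℝ≥0) : ℝ≥0∞) ≤ intrinsicSpectralRadius M := by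
    intro k
    refine (C k).le_intrinsicSpectralRadius M _ (le_trans ?_ (Finset.prod_le_prod'
      fun i _ => hterm k i))
    -- With `m` old vertices the product is at least `q k ^ (length + N k * m)`, and `N k * m ≤
    -- length` by the choice of the cycles.
    rw [Finset.prod_mul_distrib, Finset.prod_ite, Finset.prod_const, Finset.prod_const,
      Finset.prod_const, one_pow, mul_one, ← pow_mul, mul_pow, Finset.card_univ, Fintype.card_fin]
    exact mul_le_mul_right (pow_le_pow_of_le_one zero_le (hq1 k).le (hC k)) _
  have hqlim : Filter.Tendsto q Filter.atTop (nhds 1) := by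
    rw [← NNReal.tendsto_coe]
    have h1 := (tendsto_one_div_add_atTop_nhds_zero_nat (𝕜 := ℝ)).comp
      (Filter.tendsto_add_atTop_nat 1)
    have h2 := h1.const_sub 1
    rw [sub_zero] at h2
    refine h2.congr fun k => ?_
    simp only [q, Function.comp]
    push_cast
    field_simp
    ring
  have hge : 1 ≤ intrinsicSpectralRadius M := by
    have h1 := ENNReal.tendsto_coe.2 (hqlim.mul hqlim)
    rw [mul_one, ENNReal.coe_one] at h1
    exact le_of_tendsto' h1 hcycle
  have heq := le_antisymm hle hge
  refine ⟨M, hMD, by simp [heq], fun v w => ?_⟩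
  simp only [heq, one_pow, div_one]
  exact tsum_matPow_lt_top (fun v => half_pos (hδ0 (f v))) hrow v w

end InfDigraph

theorem theorem1 {V : Type*} [Countable V] (D : Digraph V)
    (hstrong : InfDigraph.IsStrong D) (harc : ∃ v w : V, D.Adj v w) :
    InfDigraph.transientMatrices D = ∅ ↔
      (∃ W : Set V, W.Finite ∧ InfDigraph.IsCycleTransversal D W) ∧
        ∃ L : ℕ, ∀ n : ℕ, InfDigraph.HasCycleOfLength D n → n ≤ L := by
  constructor
  · intro hempty
    by_contra h
    obtain ⟨M, hMD, hM⟩ := InfDigraph.exists_isTransient h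
    exact Set.eq_empty_iff_forall_notMem.1 hempty M ⟨hMD, hM⟩
  · rintro ⟨⟨W, hfin, hW⟩, L, hL⟩
    exact Set.eq_empty_iff_forall_notMem.2 fun M hM =>
      InfDigraph.not_isTransient hstrong harc hfin hW hL hM.1 hM.2
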